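/- Let $n,k$ be non-negative integers. The Yangian $\mathrm Y(n)=\mathrm Y(\mathfrak{gl}_n)$ is the complex unital associative algebra with generators $t_{ij}^{(1)},t_{ij}^{(2)},\dots$, $1\le i,j\le n$, and defining relations $$(u-v)\,[t_{ij}(u),t_{kl}(v)]=t_{kj}(u)\,t_{il}(v)-t_{kj}(v)\,t_{il}(u),\qquad t_{ij}(u)=\delta_{ij}+\sum_{r\ge1}t_{ij}^{(r)}u^{-r}.$$ It is a bialgebra with coproduct $\Delta(t_{ij}(u))=\sum_{a=1}^n t_{ia}(u)\otimes t_{aj}(u)$ and counit $\varepsilon(t_{ij}(u))=\delta_{ij}$. A $\mathfrak{gl}_n$-highest weight is an $n$-tuple $\lambda=(\lambda_1,\dots,\lambda_n)\in\mathbb C^n$ with $\lambda_i-\lambda_{i+1}\in\mathbb Z_{\ge0}$ for $1\le i<n$; for such $\lambda$ let $L(\lambda)$ be the irreducible finite-dimensional $\mathfrak{gl}_n$-module with highest weight $\lambda$ with respect to the upper triangular Borel subalgebra (it is determined up to isomorphism), regarded as a $\mathrm Y(n)$-module through the evaluation homomorphism $\mathrm Y(n)\to\mathrm U(\mathfrak{gl}_n)$,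 $t_{ij}(u)\mapsto\delta_{ij}+E_{ij}u^{-1}$. Tensor products of $\mathrm Y(n)$-modules are $\mathrm Y(n)$-modules through (iterates of) $\Delta$; the empty tensor product is $\mathbb C$ with the action given by $\varepsilon$. **Proposition.** Let $\lambda^{(1)},\dots,\lambda^{(k)}$ be $\mathfrak{gl}_n$-highest weights, let $c\in\mathbb C$, and let $\lambda^{(p)}+c$ denote the $n$-tuple with components $\lambda^{(p)}_i+c$. Then the $\mathrm Y(n)$-module $$L(\lambda^{(1)})\otimes L(\lambda^{(2)})\otimes\cdots\otimes L(\lambda^{(k)})$$ is irreducible if and only if the $\mathrm Y(n)$-module $$L(\lambda^{(1)}+c)\otimes L(\lambda^{(2)}+c)\otimes\cdots\otimes L(\lambda^{(k)}+c)$$ is irreducible. -/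

import Mathlib

open scoped TensorProduct

/- An associative algebra is regarded as a Lie algebra under the commutator `⁅x, y⁆ = x * y - y * x`.
In particular `Matrix (Fin n) (Fin n) ℂ` is the Lie algebra `gl_n`. -/
attribute [local instance] LieRing.ofAssociativeRing

noncomputable section

/-! ### The Yangian of `gl_n` -/

/-- A family `T i j r` of elements of an algebra `A`, read as the coefficients of the series
`T_ij(u) = ∑_r T i j r * u^{-r}`, satisfies the defining relations of the Yangian:
`T_ij(u) = δ_ij + O(u^{-1})`, and
`(u - v) [T_ij(u), T_kl(v)] = T_kj(u) T_il(v) - T_kj(v) T_il(u)`,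
the latter being written out by comparing the coefficients of `u^{-r} v^{-s}`
(the coefficients of `u^{1} v^{-s}` and `u^{-r} v^{1}` give only that `T i j 0` commutes with
everything, which holds as it is a scalar). -/
structure IsYangianFamily {n : ℕ} {A : Type*} [Ring A] (T : Fin n → Fin n → ℕ → A) : Prop where
  zero : ∀ i j, T i j 0 = if i = j then 1 else 0
  rel : ∀ (i j k l : Fin n) (r s : ℕ),
    (T i j (r + 1) * T k l s - T k l s * T i j (r + 1))
      - (T i j r * T k l (s + 1) - T k l (s + 1) * T i j r)
      = T k j r * T i l s - T k j s * T i l r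

/-- The family `t_ij^{(r)}`, `r ≥ 0`, in the free algebra on the symbols `(i, j, r)`, where
`(i, j, r)` stands for `t_ij^{(r + 1)}` and where `t_ij^{(0)} = δ_ij`. -/
def freeT (n : ℕ) (i j : Fin n) : ℕ → FreeAlgebra ℂ (Fin n × Fin n × ℕ)
  | 0 => if i = j then 1 else 0
  | r + 1 => FreeAlgebra.ι ℂ (i, j, r)

/-- The defining relations of the Yangian. -/
inductive YangianRel (n : ℕ) :
    FreeAlgebra ℂ (Fin n × Fin n × ℕ) → FreeAlgebra ℂ (Fin n × Fin n × ℕ) → Prop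
  | mk (i j k l : Fin n) (r s : ℕ) : YangianRel n
      ((freeT n i j (r + 1) * freeT n k l s - freeT n k l s * freeT n i j (r + 1))
        - (freeT n i j r * freeT n k l (s + 1) - freeT n k l (s + 1) * freeT n i j r))
      (freeT n k j r * freeT n i l s - freeT n k j s * freeT n i l r)

/-- The Yangian `Y(n) = Y(gl_n)`: the complex associative unital algebra with generators
`t_ij^{(1)}, t_ij^{(2)}, …` and the above relations. -/
def Yangian (n : ℕ) : Type := RingQuot (YangianRel n)

namespace Yangian

instance instRing (n : ℕ) : Ring (Yangian n) := inferInstanceAs (Ring (RingQuot (YangianRel n)))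

instance instAlgebra (n : ℕ) : Algebra ℂ (Yangian n) :=
  inferInstanceAs (Algebra ℂ (RingQuot (YangianRel n)))

/-- The element `t_ij^{(r)}` of the Yangian, with `t_ij^{(0)} = δ_ij`. -/
def t {n : ℕ} (i j : Fin n) (r : ℕ) : Yangian n :=
  RingQuot.mkAlgHom ℂ (YangianRel n) (freeT n i j r)

theorem isYangianFamily_t (n : ℕ) : IsYangianFamily (t : Fin n → Fin n → ℕ → Yangian n) where
  zero i j := by
    unfold t freeT
    split_ifs
    · exact map_one (RingQuot.mkAlgHom ℂ (YangianRel n))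
    · exact map_zero (RingQuot.mkAlgHom ℂ (YangianRel n))
  rel i j k l r s := by
    have h := RingQuot.mkAlgHom_rel ℂ (YangianRel.mk i j k l r s)
    simp only [map_sub, map_mul] at h
    exact h

/-- The universal property of the Yangian: a family in `A` that satisfies the defining relations
gives a homomorphism `Y(n) → A`, `t_ij^{(r)} ↦ T i j r`. -/
def lift {n : ℕ} {A : Type*} [Ring A] [Algebra ℂ A] (T : Fin n → Fin n → ℕ → A)
    (hT : IsYangianFamily T) : Yangian n →ₐ[ℂ] A :=
  RingQuot.liftAlgHom ℂ
    ⟨FreeAlgebra.lift ℂ fun x => T x.1 x.2.1 (x.2.2 + 1), by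
      have key : ∀ i j r, FreeAlgebra.lift ℂ
          (fun x : Fin n × Fin n × ℕ => T x.1 x.2.1 (x.2.2 + 1)) (freeT n i j r) = T i j r := by
        intro i j r
        cases r with
        | zero =>
          rw [hT.zero]
          unfold freeT
          split_ifs <;> simp
        | succ r => simp [freeT]
      rintro _ _ ⟨i, j, k, l, r, s⟩
      simp only [map_sub, map_mul, key]
      exact hT.rel i j k l r s⟩

theorem lift_t {n : ℕ} {A : Type*} [Ring A] [Algebra ℂ A] (T : Fin n → Fin n → ℕ → A)
    (hT : IsYangianFamily T) (i j : Fin n) (r : ℕ) : lift T hT (t i j r) = T i j r := by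
  unfold lift t
  erw [RingQuot.liftAlgHom_mkAlgHom_apply]
  cases r with
  | zero =>
    rw [hT.zero]
    unfold freeT
    split_ifs <;> simp
  | succ r => simp [freeT]

end Yangian

/-! ### The Hopf structure -/

/-- The product `P(u) Q(u)` of two commuting solutions of the relations of the Yangian (in abstract
form: unprimed letters are series in `u`, primed ones are series in `v`). -/
theorem rtt_mul_aux {n : ℕ} {B : Type*} [Ring B] (d e : B) (hd : ∀ x, d * x = x * d)
    (he : ∀ x, e * x = x * e) (p p' q q' : Fin n → Fin n → B)
    (hp : ∀ i j k l, d * (p i j * p' k l - p' k l * p i j)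
      = e * (p k j * p' i l - p' k j * p i l))
    (hq : ∀ i j k l, d * (q i j * q' k l - q' k l * q i j)
      = e * (q k j * q' i l - q' k j * q i l))
    (_ : ∀ i j k l, Commute (p i j) (q k l)) (c2 : ∀ i j k l, Commute (p i j) (q' k l))
    (c3 : ∀ i j k l, Commute (p' i j) (q k l)) (_ : ∀ i j k l, Commute (p' i j) (q' k l))
    (i j k l : Fin n) :
    d * ((∑ a, p i a * q a j) * (∑ b, p' k b * q' b l)
        - (∑ b, p' k b * q' b l) * (∑ a, p i a * q a j))
      = e * ((∑ a, p k a * q a j) * (∑ b, p' i b * q' b l)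
        - (∑ a, p' k a * q' a j) * (∑ b, p i b * q b l)) := by
  have swap : ∀ x y z w : B, Commute y z → (x * y) * (z * w) = (x * z) * (y * w) := by
    intro x y z w h
    rw [mul_assoc, ← mul_assoc y, h.eq, mul_assoc z, ← mul_assoc]
  have L1 : ∀ a b, d * ((p i a * q a j) * (p' k b * q' b l)
        - (p' k b * q' b l) * (p i a * q a j))
      = e * ((p k a * p' i b - p' k a * p i b) * (q a j * q' b l))
        + e * ((p' k b * p i a) * (q b j * q' a l - q' b j * q a l)) := by
    intro a b
    have h1 : d * ((p i a * p' k b - p' k b * p i a) * (q a j * q' b l))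
        = e * ((p k a * p' i b - p' k a * p i b) * (q a j * q' b l)) := by
      rw [← mul_assoc, hp i a k b, mul_assoc]
    have h2 : d * ((p' k b * p i a) * (q a j * q' b l - q' b l * q a j))
        = e * ((p' k b * p i a) * (q b j * q' a l - q' b j * q a l)) := by
      rw [← mul_assoc, hd, mul_assoc, hq a j b l, ← mul_assoc, ← he, mul_assoc]
    rw [← h1, ← h2, swap _ _ _ _ (c3 k b a j).symm, swap _ _ _ _ (c2 i a b l).symm, ← mul_add]
    congr 1
    noncomm_ring
  have R1 : ∀ a b, (p k a * q a j) * (p' i b * q' b l) = (p k a * p' i b) * (q a j * q' b l) :=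
    fun a b => swap _ _ _ _ (c3 i b a j).symm
  have R2 : ∀ a b, (p' k a * q' a j) * (p i b * q b l) = (p' k a * p i b) * (q' a j * q b l) :=
    fun a b => swap _ _ _ _ (c2 i b a j).symm
  have E1 : d * ((∑ a, p i a * q a j) * (∑ b, p' k b * q' b l)
        - (∑ b, p' k b * q' b l) * (∑ a, p i a * q a j))
      = ∑ a, ∑ b, d * ((p i a * q a j) * (p' k b * q' b l)
        - (p' k b * q' b l) * (p i a * q a j)) := by
    rw [Finset.sum_mul_sum, Finset.sum_mul_sum (s := Finset.univ) (t := Finset.univ)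
      (f := fun b => p' k b * q' b l) (g := fun a => p i a * q a j)]
    rw [Finset.sum_comm (f := fun b a => p' k b * q' b l * (p i a * q a j)),
      ← Finset.sum_sub_distrib, Finset.mul_sum]
    refine Finset.sum_congr rfl fun a _ => ?_
    rw [← Finset.sum_sub_distrib, Finset.mul_sum]
  have E2 : e * ((∑ a, p k a * q a j) * (∑ b, p' i b * q' b l)
        - (∑ a, p' k a * q' a j) * (∑ b, p i b * q b l))
      = ∑ a, ∑ b, (e * ((p k a * p' i b) * (q a j * q' b l))
        - e * ((p' k a * p i b) * (q' a j * q b l))) := by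
    rw [Finset.sum_mul_sum, Finset.sum_mul_sum, ← Finset.sum_sub_distrib, Finset.mul_sum]
    refine Finset.sum_congr rfl fun a _ => ?_
    rw [← Finset.sum_sub_distrib, Finset.mul_sum]
    refine Finset.sum_congr rfl fun b _ => ?_
    rw [R1, R2, mul_sub]
  have S : ∑ a, ∑ b, e * ((p' k b * p i a) * (q b j * q' a l - q' b j * q a l))
      = ∑ a, ∑ b, e * ((p' k a * p i b) * (q a j * q' b l - q' a j * q b l)) :=
    Finset.sum_comm
  rw [E1, E2]
  simp_rw [L1, Finset.sum_add_distrib]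
  rw [S, ← Finset.sum_add_distrib]
  refine Finset.sum_congr rfl fun a _ => ?_
  rw [← Finset.sum_add_distrib]
  refine Finset.sum_congr rfl fun b _ => ?_
  noncomm_ring

/-- The coefficients of the entries `∑_a P_ia(u) Q_aj(u)` of the matrix product `P(u) Q(u)`. -/
def mulFamily {n : ℕ} {A : Type*} [Ring A] (P Q : Fin n → Fin n → ℕ → A)
    (i j : Fin n) (r : ℕ) : A :=
  ∑ a, ∑ x ∈ Finset.HasAntidiagonal.antidiagonal r, P i a x.1 * Q a j x.2

open PowerSeries in
/-- The two-variable power series form of a coefficientwise commutation relation. -/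
theorem rel_iff_powerSeries {A : Type*} [Ring A] (f g f₁ g₁ f₂ g₂ : ℕ → A)
    (hf : ∀ x, Commute (f 0) x) (hg : ∀ x, Commute x (g 0)) :
    (∀ r s : ℕ, (f (r + 1) * g s - g s * f (r + 1)) - (f r * g (s + 1) - g (s + 1) * f r)
      = f₁ r * g₁ s - g₂ s * f₂ r) ↔
    ((X - C X : A⟦X⟧⟦X⟧) * (C (mk f) * map C (mk g) - map C (mk g) * C (mk f))
      = (C X * X) * (C (mk f₁) * map C (mk g₁) - map C (mk g₂) * C (mk f₂))) := by
  have k1 : ∀ (a b : ℕ → A) (r s : ℕ),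
      coeff r (coeff s (C (mk a) * map C (mk b))) = a r * b s := by
    intro a b r s
    simp [coeff_C_mul, coeff_mul_C]
  have k2 : ∀ (a b : ℕ → A) (r s : ℕ),
      coeff r (coeff s (map C (mk b) * C (mk a))) = b s * a r := by
    intro a b r s
    simp [coeff_C_mul, coeff_mul_C]
  have x0 : ∀ (F : A⟦X⟧⟦X⟧) r, coeff r (coeff 0 (X * F)) = 0 := by
    intro F r; simp
  have x1 : ∀ (F : A⟦X⟧⟦X⟧) r s, coeff r (coeff (s + 1) (X * F)) = coeff r (coeff s F) := by
    intro F r s; rw [coeff_succ_X_mul]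
  have y0 : ∀ (F : A⟦X⟧⟦X⟧) s, coeff 0 (coeff s (C X * F)) = 0 := by
    intro F s; simp [coeff_C_mul]
  have y1 : ∀ (F : A⟦X⟧⟦X⟧) r s, coeff (r + 1) (coeff s (C X * F)) = coeff r (coeff s F) := by
    intro F r s; rw [coeff_C_mul, coeff_succ_X_mul]
  constructor
  · intro h
    ext s r
    rcases s with _ | s <;> rcases r with _ | r
    all_goals simp only [sub_mul (X : A⟦X⟧⟦X⟧), mul_assoc (C X : A⟦X⟧⟦X⟧), map_sub, x0, x1, y0, y1,
      k1, k2]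
    · simp
    · simp [(hg (f r)).eq]
    · simp [(hf (g s)).eq]
    · rw [← h r s]
  · intro h r s
    have := congrArg (fun F => coeff (r + 1) (coeff (s + 1) F)) h
    simp only [sub_mul (X : A⟦X⟧⟦X⟧), mul_assoc (C X : A⟦X⟧⟦X⟧), map_sub, x1, y1, k1, k2] at this
    rw [← this]

open PowerSeries in
/-- The product of two commuting families that satisfy the relations of the Yangian satisfies
them. -/
theorem isYangianFamily_mulFamily {n : ℕ} {A : Type*} [Ring A] {P Q : Fin n → Fin n → ℕ → A}
    (hP : IsYangianFamily P) (hQ : IsYangianFamily Q)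
    (h : ∀ i j r k l s, Commute (P i j r) (Q k l s)) : IsYangianFamily (mulFamily P Q) := by
  have hz : ∀ i j, mulFamily P Q i j 0 = if i = j then 1 else 0 := by
    intro i j
    simp [mulFamily, hP.zero, hQ.zero]
  have z : ∀ {T : Fin n → Fin n → ℕ → A}, (∀ i j, T i j 0 = if i = j then 1 else 0) →
      ∀ i j x, Commute (T i j 0) x := by
    intro T hT i j x
    rw [hT]
    split_ifs
    · exact Commute.one_left x
    · exact Commute.zero_left x
  have hm : ∀ i j, mk (mulFamily P Q i j) = ∑ a, mk (P i a) * mk (Q a j) := by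
    intro i j
    ext r
    simp [mulFamily, coeff_mul]
  refine ⟨hz, fun i j k l => ?_⟩
  rw [rel_iff_powerSeries _ _ _ _ _ _ (z hz i j) fun x => (z hz k l x).symm]
  simp only [hm, map_sum, map_mul]
  have cm : ∀ i j k l, Commute (mk (P i j)) (mk (Q k l)) := by
    intro i j k l
    ext r
    simp only [coeff_mul, coeff_mk]
    rw [← Finset.Nat.sum_antidiagonal_swap]
    exact Finset.sum_congr rfl fun x _ => (h ..).eq
  have cX : ∀ x : A⟦X⟧⟦X⟧, C X * x = x * C X := by
    intro x
    ext s r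
    simp only [coeff_C_mul, coeff_mul_C]
    rw [(commute_X _).eq]
  have cXX : ∀ x : A⟦X⟧⟦X⟧, X * x = x * X := fun x => (commute_X x).eq.symm
  refine rtt_mul_aux _ _ ?_ ?_ (fun i j => C (mk (P i j))) (fun i j => map C (mk (P i j)))
    (fun i j => C (mk (Q i j))) (fun i j => map C (mk (Q i j))) ?_ ?_ ?_ ?_ ?_ ?_ i j k l
  · intro x
    rw [sub_mul, mul_sub, cX, cXX]
  · intro x
    rw [mul_assoc, cXX, ← mul_assoc, cX, mul_assoc]
  · intro i j k l
    exact (rel_iff_powerSeries _ _ _ _ _ _ (z hP.zero i j) fun x => (z hP.zero k l x).symm).1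
      (hP.rel i j k l)
  · intro i j k l
    exact (rel_iff_powerSeries _ _ _ _ _ _ (z hQ.zero i j) fun x => (z hQ.zero k l x).symm).1
      (hQ.rel i j k l)
  · intro i j k l
    exact (cm i j k l).map C
  · intro i j k l
    show _ = _
    ext s r
    simp only [coeff_C_mul, coeff_mul_C, coeff_map, coeff_mk]
    simp [(h ..).eq]
  · intro i j k l
    show _ = _
    ext s r
    simp only [coeff_C_mul, coeff_mul_C, coeff_map, coeff_mk]
    simp [(h ..).eq]
  · intro i j k l
    exact (cm i j k l).map (map C)

namespace Yangian

/-- The coproduct `Δ(t_ij(u)) = ∑_a t_ia(u) ⊗ t_aj(u)`. -/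
def comul (n : ℕ) : Yangian n →ₐ[ℂ] Yangian n ⊗[ℂ] Yangian n :=
  lift (fun i j r => ∑ a, ∑ x ∈ Finset.HasAntidiagonal.antidiagonal r, t i a x.1 ⊗ₜ[ℂ] t a j x.2)
    (by
      have hl : IsYangianFamily (fun i j r => (t i j r : Yangian n) ⊗ₜ[ℂ] (1 : Yangian n)) := by
        refine ⟨fun i j => ?_, fun i j k l r s => ?_⟩
        · rw [(isYangianFamily_t n).zero]
          split_ifs
          · rfl
          · simp
        · simp only [Algebra.TensorProduct.tmul_mul_tmul, one_mul, ← TensorProduct.sub_tmul,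
            (isYangianFamily_t n).rel]
      have hr : IsYangianFamily (fun i j r => (1 : Yangian n) ⊗ₜ[ℂ] (t i j r : Yangian n)) := by
        refine ⟨fun i j => ?_, fun i j k l r s => ?_⟩
        · rw [(isYangianFamily_t n).zero]
          split_ifs
          · rfl
          · simp
        · simp only [Algebra.TensorProduct.tmul_mul_tmul, one_mul, ← TensorProduct.tmul_sub,
            (isYangianFamily_t n).rel]
      have := isYangianFamily_mulFamily hl hr fun i j r k l s => by
        simp [Commute, SemiconjBy]
      unfold mulFamily at this
      simpa only [Algebra.TensorProduct.tmul_mul_tmul, one_mul, mul_one] using this)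

/-- The counit `ε(t_ij(u)) = δ_ij`. -/
def counit (n : ℕ) : Yangian n →ₐ[ℂ] ℂ :=
  lift (fun i j r => if r = 0 ∧ i = j then 1 else 0)
    ⟨fun i j => by simp, fun i j k l r s => by
      by_cases hr : r = 0 <;> by_cases hs : s = 0 <;> by_cases h1 : k = j <;>
        by_cases h2 : i = l <;> simp [hr, hs, h1, h2]⟩

/-- The isomorphism `A ⊗ A^{⊗k} → A^{⊗(k+1)}`, `x ⊗ (y₁ ⊗ ⋯ ⊗ y_k) ↦ x ⊗ y₁ ⊗ ⋯ ⊗ y_k`, as a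
linear map. -/
def tensorConsLinear (A : Type*) [Ring A] [Algebra ℂ A] (k : ℕ) :
    A ⊗[ℂ] (⨂[ℂ] _ : Fin k, A) →ₗ[ℂ] ⨂[ℂ] _ : Fin (k + 1), A :=
  TensorProduct.lift
    ((PiTensorProduct.lift (R := ℂ)).toLinearMap ∘ₗ
      (PiTensorProduct.tprod ℂ (s := fun _ : Fin (k + 1) => A)).curryLeft)

theorem tensorConsLinear_tmul_tprod (A : Type*) [Ring A] [Algebra ℂ A] (k : ℕ) (x : A)
    (y : Fin k → A) :
    tensorConsLinear A k (x ⊗ₜ PiTensorProduct.tprod ℂ y)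
      = PiTensorProduct.tprod ℂ (Fin.cons x y : Fin (k + 1) → A) := by
  simp [tensorConsLinear]

/-- The isomorphism `A ⊗ A^{⊗k} → A^{⊗(k+1)}` as a homomorphism of algebras. -/
def tensorCons (A : Type*) [Ring A] [Algebra ℂ A] (k : ℕ) :
    A ⊗[ℂ] (⨂[ℂ] _ : Fin k, A) →ₐ[ℂ] ⨂[ℂ] _ : Fin (k + 1), A :=
  Algebra.TensorProduct.algHomOfLinearMapTensorProduct (tensorConsLinear A k)
    (by
      intro a b x y
      induction x using PiTensorProduct.induction_on with
      | add x x' hx hx' => simp only [add_mul, TensorProduct.tmul_add, map_add, hx, hx']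
      | smul_tprod c x =>
        induction y using PiTensorProduct.induction_on with
        | add y y' hy hy' => simp only [mul_add, TensorProduct.tmul_add, map_add, hy, hy']
        | smul_tprod d y =>
          simp only [smul_mul_assoc, mul_smul_comm, TensorProduct.tmul_smul, map_smul,
            PiTensorProduct.tprod_mul_tprod, tensorConsLinear_tmul_tprod]
          congr 3
          ext i
          refine Fin.cases ?_ (fun i => ?_) i <;> simp)
    (by
      rw [PiTensorProduct.one_def, tensorConsLinear_tmul_tprod, PiTensorProduct.one_def]
      congr 1
      ext i
      refine Fin.cases ?_ (fun i => ?_) i <;> simp)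

/-- The iterated coproduct `Δ^{(k)} : Y(n) → Y(n)^{⊗k}`: the counit for `k = 0`, and
`Δ^{(k + 1)} = (id ⊗ Δ^{(k)}) ∘ Δ`. -/
def iteratedComul (n : ℕ) : (k : ℕ) → Yangian n →ₐ[ℂ] ⨂[ℂ] _ : Fin k, Yangian n
  | 0 => (Algebra.ofId ℂ (⨂[ℂ] _ : Fin 0, Yangian n)).comp (counit n)
  | k + 1 => (tensorCons (Yangian n) k).comp
      ((Algebra.TensorProduct.map (AlgHom.id ℂ (Yangian n)) (iteratedComul n k)).comp (comul n))

/-! ### Modules over the Yangian -/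

/-- If an algebra `A` acts on each `V p` by `ρ p`, then `A^{⊗k}` acts on `V 1 ⊗ ⋯ ⊗ V k`, factor by
factor. -/
def outerTensor {A : Type*} [Ring A] [Algebra ℂ A] {k : ℕ} {V : Fin k → Type*}
    [∀ p, AddCommGroup (V p)] [∀ p, Module ℂ (V p)] (ρ : ∀ p, A →ₐ[ℂ] Module.End ℂ (V p)) :
    (⨂[ℂ] _ : Fin k, A) →ₐ[ℂ] Module.End ℂ (⨂[ℂ] p, V p) :=
  PiTensorProduct.liftAlgHom
    ((PiTensorProduct.mapMultilinear ℂ V V).compLinearMap fun p => (ρ p).toLinearMap)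
    (by
      apply PiTensorProduct.ext
      ext v
      simp)
    (by
      intro x y
      apply PiTensorProduct.ext
      ext v
      simp)

/-- The tensor product `V 1 ⊗ ⋯ ⊗ V k` of modules over the Yangian, with the action defined by the
iterated coproduct. -/
def tensorRep {n k : ℕ} {V : Fin k → Type*} [∀ p, AddCommGroup (V p)] [∀ p, Module ℂ (V p)]
    (ρ : ∀ p, Yangian n →ₐ[ℂ] Module.End ℂ (V p)) :
    Yangian n →ₐ[ℂ] Module.End ℂ (⨂[ℂ] p, V p) :=
  (outerTensor ρ).comp (iteratedComul n k)

/-- If elements `E i j` of an algebra satisfy the commutation relations of `gl_n`, then the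
coefficients of `δ_ij + E_ij u^{-1}` satisfy the relations of the Yangian. -/
theorem isYangianFamily_eval {n : ℕ} {A : Type*} [Ring A] (E : Fin n → Fin n → A)
    (hE : ∀ i j k l, E i j * E k l - E k l * E i j
      = (if k = j then E i l else 0) - if i = l then E k j else 0) :
    IsYangianFamily fun i j r => match r with
      | 0 => if i = j then 1 else 0
      | 1 => E i j
      | _ + 2 => 0 := by
  refine ⟨fun i j => rfl, fun i j k l r s => ?_⟩
  rcases r with _ | _ | r <;> rcases s with _ | _ | s
  all_goals simp [hE]

/-- The evaluation homomorphism `Y(n) → U(gl_n)`, `t_ij(u) ↦ δ_ij + E_ij u^{-1}`. -/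
def evalHom (n : ℕ) :
    Yangian n →ₐ[ℂ] UniversalEnvelopingAlgebra ℂ (Matrix (Fin n) (Fin n) ℂ) :=
  lift
    (fun i j r => match r with
      | 0 => if i = j then 1 else 0
      | 1 => UniversalEnvelopingAlgebra.ι ℂ (Matrix.single i j (1 : ℂ))
      | _ + 2 => 0)
    (isYangianFamily_eval
      (fun i j => UniversalEnvelopingAlgebra.ι ℂ (Matrix.single i j (1 : ℂ)))
      fun i j k l => by
        rw [← LieRing.of_associative_ring_bracket, ← LieHom.map_lie,
          LieRing.of_associative_ring_bracket, map_sub]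
        congr 1
        · split_ifs with h
          · subst h; simp
          · rw [Matrix.single_mul_single_of_ne (h := fun h' => h h'.symm), map_zero]
        · split_ifs with h
          · subst h; simp
          · rw [Matrix.single_mul_single_of_ne (h := fun h' => h h'.symm), map_zero])

/-- The evaluation module: a `gl_n`-module regarded as a `Y(n)`-module through the evaluation
homomorphism. -/
def evalRep (n : ℕ) (V : Type*) [AddCommGroup V] [Module ℂ V]
    [LieRingModule (Matrix (Fin n) (Fin n) ℂ) V] [LieModule ℂ (Matrix (Fin n) (Fin n) ℂ) V] :
    Yangian n →ₐ[ℂ] Module.End ℂ V :=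
  (UniversalEnvelopingAlgebra.lift ℂ (LieModule.toEnd ℂ (Matrix (Fin n) (Fin n) ℂ) V)).comp
    (evalHom n)

/-- The module given by `ρ` is irreducible: it is nonzero, and its only submodules are zero and
itself. -/
def IsIrreducibleRep {A M : Type*} [Ring A] [Algebra ℂ A] [AddCommGroup M] [Module ℂ M]
    (ρ : A →ₐ[ℂ] Module.End ℂ M) : Prop :=
  @IsSimpleModule A _ M _ (Module.compHom M (ρ : A →+* Module.End ℂ M))

end Yangian

/-! ### Highest weight modules of `gl_n` -/

/-- A `gl_n`-highest weight: an `n`-tuple of complex numbers with `λ_i - λ_{i+1} ∈ ℤ_{≥ 0}`. -/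
def IsGlHighestWeight {n : ℕ} (lam : Fin n → ℂ) : Prop :=
  ∀ i j : Fin n, (i : ℕ) + 1 = j → ∃ m : ℕ, lam i - lam j = m

/-- `V` is (a copy of) `L(λ)`: an irreducible finite-dimensional `gl_n`-module with highest weight
`λ` with respect to the upper triangular Borel subalgebra. -/
structure IsGlIrrep {n : ℕ} (lam : Fin n → ℂ) (V : Type*) [AddCommGroup V] [Module ℂ V]
    [LieRingModule (Matrix (Fin n) (Fin n) ℂ) V] [LieModule ℂ (Matrix (Fin n) (Fin n) ℂ) V] :
    Prop where
  finiteDimensional : FiniteDimensional ℂ V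
  irreducible : LieModule.IsIrreducible ℂ (Matrix (Fin n) (Fin n) ℂ) V
  exists_highestWeightVector : ∃ v : V, v ≠ 0 ∧
    (∀ i j : Fin n, i < j → ⁅(Matrix.single i j 1 : Matrix (Fin n) (Fin n) ℂ), v⁆ = 0) ∧
    ∀ i : Fin n, ⁅(Matrix.single i i 1 : Matrix (Fin n) (Fin n) ℂ), v⁆ = lam i • v

end

/-! Two facts carry the proof. First, $L(\lambda+c)$ is $L(\lambda)$ with $E_{ij}$ acting as
$E_{ij}+\delta_{ij}c$: this changes neither the invariant subspaces nor the highest weight vectors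
and shifts the weight by $c$, so uniqueness of the irreducible module with a given highest weight
(`exists_linearEquiv_of_isHighestWeightVector`) applies.

Second, let $E_p$ be the matrix of operators of the $p$-th factor. On a tensor product of evaluation
modules the matrix $t(u)$ acts as $(1+E_1u^{-1})\cdots(1+E_ku^{-1})$ (`tensorRep_evalRep_t`), which
is $u^{-k}P(u)$ with $P(u)=(u+E_1)\cdots(u+E_k)$. Adding $c$ to every $E_p$ replaces $P(u)$ by
$P(u+c)$. Entry by entry, the coefficients of $P(u+c)$ are complex linear combinations of those of
$P(u)$, and conversely by the shift $-c$ (`prodFamily_evalFamily_shift_mem`).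

The generators therefore preserve the same subspaces in both actions, and irreducibility depends
only on these subspaces (`isIrreducibleRep_iff`). -/

noncomputable section

/-! ### Ordered products of families -/

/-- The coefficients of the product `T_1(u) ⋯ T_k(u)` of matrices of series. -/
def prodFamily {n : ℕ} {A : Type*} [Ring A] :
    (k : ℕ) → (Fin k → Fin n → Fin n → ℕ → A) → Fin n → Fin n → ℕ → A
  | 0, _ => fun i j r => if r = 0 ∧ i = j then 1 else 0
  | k + 1, T => mulFamily (T 0) (prodFamily k fun p => T p.succ)

theorem map_prodFamily {n : ℕ} {A B : Type*} [Ring A] [Ring B] (f : A →+* B) (k : ℕ)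
    (T : Fin k → Fin n → Fin n → ℕ → A) (i j : Fin n) (r : ℕ) :
    f (prodFamily k T i j r) = prodFamily k (fun p i j r => f (T p i j r)) i j r := by
  induction k generalizing i j r with
  | zero =>
    simp only [prodFamily]
    split_ifs <;> simp
  | succ k ih => simp [prodFamily, mulFamily, ih]

/-- The coefficients of `1 + E u^{-1}`. -/
def evalFamily {n : ℕ} {A : Type*} [Ring A] (E : Matrix (Fin n) (Fin n) A) (i j : Fin n) : ℕ → A
  | 0 => if i = j then 1 else 0
  | 1 => E i j
  | _ + 2 => 0

open Polynomial in
/-- The product `(X + E_1) ⋯ (X + E_k)`. -/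
def linearProd {R : Type*} [Ring R] {k : ℕ} (E : Fin k → R) : R[X] :=
  (List.ofFn fun p => X + C (E p)).prod

/-! ### Products of evaluation matrices and the substitution $u\mapsto u+c$. -/

section EvalFamily

variable {n : ℕ} {A : Type*} [Ring A]

theorem mulFamily_evalFamily_zero (E : Matrix (Fin n) (Fin n) A) (Q : Fin n → Fin n → ℕ → A)
    (i j : Fin n) : mulFamily (evalFamily E) Q i j 0 = Q i j 0 := by
  simp [mulFamily, evalFamily]

theorem mulFamily_evalFamily_succ (E : Matrix (Fin n) (Fin n) A) (Q : Fin n → Fin n → ℕ → A)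
    (i j : Fin n) (r : ℕ) :
    mulFamily (evalFamily E) Q i j (r + 1) = Q i j (r + 1) + ∑ a, E i a * Q a j r := by
  have h : ∀ a, ∑ x ∈ Finset.HasAntidiagonal.antidiagonal (r + 1), evalFamily E i a x.1 * Q a j x.2
      = (if i = a then 1 else 0) * Q a j (r + 1) + E i a * Q a j r := by
    intro a
    rw [Finset.Nat.sum_antidiagonal_succ]
    congr 1
    rcases r with _ | r
    · simp [evalFamily]
    · rw [Finset.Nat.sum_antidiagonal_succ]
      simp [evalFamily]
  simp [mulFamily, h, Finset.sum_add_distrib]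

theorem prodFamily_evalFamily_eq_zero {k : ℕ} (E : Fin k → Matrix (Fin n) (Fin n) A)
    (i j : Fin n) {r : ℕ} (hr : k < r) : prodFamily k (fun p => evalFamily (E p)) i j r = 0 := by
  induction k generalizing i j r with
  | zero => simp [prodFamily, hr.ne']
  | succ k ih =>
    obtain ⟨r, rfl⟩ : ∃ s, r = s + 1 := ⟨r - 1, by omega⟩
    simp only [prodFamily]
    rw [mulFamily_evalFamily_succ, ih _ _ _ (by omega)]
    simp [ih _ _ _ (show k < r by omega)]

theorem linearProd_succ {R : Type*} [Ring R] {k : ℕ} (E : Fin (k + 1) → R) :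
    linearProd E = (Polynomial.X + Polynomial.C (E 0)) * linearProd fun p => E p.succ := by
  simp [linearProd, List.ofFn_succ]

theorem coeff_linearProd_eq_zero {R : Type*} [Ring R] {k : ℕ} (E : Fin k → R) {m : ℕ}
    (hm : k < m) : (linearProd E).coeff m = 0 := by
  induction k generalizing m with
  | zero => simp [linearProd, Polynomial.coeff_one, hm.ne']
  | succ k ih =>
    obtain ⟨m, rfl⟩ : ∃ s, m = s + 1 := ⟨m - 1, by omega⟩
    rw [linearProd_succ, add_mul, Polynomial.coeff_add, Polynomial.coeff_X_mul,
      Polynomial.coeff_C_mul, ih _ (by omega), ih _ (by omega), mul_zero, add_zero]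

/-- Multiplication by $u^k$ turns each factor $1+E_pu^{-1}$ into $u+E_p$. This moves the problem
into a polynomial ring over matrices, where a shift of the variable makes sense. -/
theorem prodFamily_evalFamily_eq_coeff {k : ℕ} (E : Fin k → Matrix (Fin n) (Fin n) A)
    (i j : Fin n) {m r : ℕ} (h : m + r = k) :
    prodFamily k (fun p => evalFamily (E p)) i j r = (linearProd E).coeff m i j := by
  induction k generalizing i j m r with
  | zero =>
    obtain ⟨rfl, rfl⟩ : m = 0 ∧ r = 0 := by omega
    simp [prodFamily, linearProd, Matrix.one_apply]
  | succ k ih =>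
    rw [linearProd_succ, add_mul, Polynomial.coeff_add, Polynomial.coeff_C_mul]
    simp only [prodFamily]
    rcases r with _ | r
    · obtain rfl : m = k + 1 := by omega
      rw [mulFamily_evalFamily_zero, Polynomial.coeff_X_mul,
        coeff_linearProd_eq_zero _ (Nat.lt_succ_self k), mul_zero, add_zero,
        ih _ _ _ (show k + 0 = k by omega)]
    · rw [mulFamily_evalFamily_succ, Matrix.add_apply, Matrix.mul_apply]
      congr 1
      · rcases m with _ | m
        -- Here $r=k$: the term of order $r+1$ exceeds the number of remaining factors, and $X$
        -- times a polynomial has no constant term.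
        · rw [prodFamily_evalFamily_eq_zero _ _ _ (by omega)]
          simp
        · rw [Polynomial.coeff_X_mul, ih _ _ _ (show m + (r + 1) = k by omega)]
      · exact Finset.sum_congr rfl fun a _ => by rw [ih _ _ _ (show m + r = k by omega)]

-- Since $c$ is central, $X+c$ commutes with all constants, so the substitution $X\mapsto X+c$ is a
-- ring homomorphism of $R[X]$ even for noncommutative $R$, and it can be applied factor by factor.
-- The powers of $X+c$ are written over $\mathbb C$ to make visible that their coefficients are
-- scalars.
open Polynomial in
theorem linearProd_add_algebraMap {R : Type*} [Ring R] [Algebra ℂ R] {k : ℕ} (E : Fin k → R)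
    (c : ℂ) : linearProd (fun p => E p + algebraMap ℂ R c)
      = (linearProd E).sum fun s a =>
          C a * (((X + C c : ℂ[X]) ^ s).map (algebraMap ℂ R)) := by
  have hc : ∀ a : R, Commute (C a) (X + C (algebraMap ℂ R c)) := fun a =>
    ((commute_X (C a)).symm).add_right ((Algebra.commute_algebraMap_right c a).map C)
  have h := map_list_prod (eval₂RingHom' C (X + C (algebraMap ℂ R c)) hc)
    (List.ofFn fun p => X + C (E p))
  have e : (linearProd E).sum (fun s a => C a * (((X + C c : ℂ[X]) ^ s).map (algebraMap ℂ R)))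
      = eval₂RingHom' C (X + C (algebraMap ℂ R c)) hc (linearProd E) := by
    simp [eval₂RingHom', eval₂_eq_sum]
  rw [e, linearProd, linearProd, h, List.map_ofFn]
  congr 2
  ext1 p
  simp [eval₂RingHom']
  abel

/-- The coefficients of `(1 + (E_1 + c) u^{-1}) ⋯ (1 + (E_k + c) u^{-1})` are linear combinations of
those of `(1 + E_1 u^{-1}) ⋯ (1 + E_k u^{-1})`. -/
theorem prodFamily_evalFamily_shift_mem [Algebra ℂ A] {k : ℕ}
    (E : Fin k → Matrix (Fin n) (Fin n) A) (c : ℂ) (i j : Fin n) (r : ℕ) (S : Submodule ℂ A)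
    (hS : ∀ r, prodFamily k (fun p => evalFamily (E p)) i j r ∈ S) :
    prodFamily k (fun p => evalFamily (E p + algebraMap ℂ _ c)) i j r ∈ S := by
  by_cases hr : k < r
  · rw [prodFamily_evalFamily_eq_zero _ _ _ hr]
    exact S.zero_mem
  · have hS' : ∀ m, (linearProd E).coeff m i j ∈ S := by
      intro m
      by_cases hm : k < m
      · rw [coeff_linearProd_eq_zero _ hm]
        exact S.zero_mem
      · rw [← prodFamily_evalFamily_eq_coeff E i j (show m + (k - m) = k by omega)]
        exact hS _
    rw [prodFamily_evalFamily_eq_coeff _ i j (show (k - r) + r = k by omega),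
      linearProd_add_algebraMap, Polynomial.sum_def, Polynomial.finsetSum_coeff, Matrix.sum_apply]
    refine S.sum_mem fun s _ => ?_
    -- A coefficient of $(X+c)^s$ is a complex number, so it multiplies the matrix entrywise and the
    -- position $(i,j)$ stays fixed.
    rw [Polynomial.coeff_C_mul, Polynomial.coeff_map, ← Algebra.commutes, ← Algebra.smul_def,
      Matrix.smul_apply]
    exact S.smul_mem _ (hS' s)

end EvalFamily

namespace Yangian

/-! ### Irreducibility in terms of the generators -/

theorem adjoin_range_t (n : ℕ) :
    Algebra.adjoin ℂ {y : Yangian n | ∃ i j r, y = t i j r} = ⊤ := by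
  rw [eq_top_iff]
  rintro y -
  obtain ⟨x, rfl⟩ := RingQuot.mkAlgHom_surjective ℂ (YangianRel n) y
  induction x using FreeAlgebra.induction with
  | grade0 a =>
    rw [AlgHom.commutes]
    exact Subalgebra.algebraMap_mem (Algebra.adjoin ℂ {y : Yangian n | ∃ i j r, y = t i j r}) a
  | grade1 x => exact Algebra.subset_adjoin ⟨x.1, x.2.1, x.2.2 + 1, rfl⟩
  | mul a b ha hb =>
    rw [map_mul]
    exact Subalgebra.mul_mem _ ha hb
  | add a b ha hb =>
    rw [map_add]
    exact Subalgebra.add_mem _ ha hb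

/-- The $t_{ij}^{(r)}$ generate the Yangian as a complex algebra, so its submodules are the complex
subspaces stable under these operators. -/
theorem isIrreducibleRep_iff {n : ℕ} {M : Type*} [AddCommGroup M] [Module ℂ M]
    (ρ : Yangian n →ₐ[ℂ] Module.End ℂ M) :
    IsIrreducibleRep ρ ↔ Nontrivial M ∧ ∀ N : Submodule ℂ M,
      (∀ i j r, ∀ m ∈ N, ρ (t i j r) m ∈ N) → N = ⊥ ∨ N = ⊤ := by
  unfold IsIrreducibleRep
  let : Module (Yangian n) M := Module.compHom M (ρ : Yangian n →+* Module.End ℂ M)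
  have hsmul : ∀ (y : Yangian n) (m : M), y • m = ρ y m := fun _ _ => rfl
  rw [isSimpleModule_iff, isSimpleOrder_iff, Submodule.nontrivial_iff]
  refine and_congr_right fun _ => ⟨fun h N hN => ?_, fun h N => ?_⟩
  · have hall : ∀ y : Yangian n, ∀ m ∈ N, ρ y m ∈ N := by
      intro y
      have hy : y ∈ Algebra.adjoin ℂ {y : Yangian n | ∃ i j r, y = t i j r} := by
        rw [adjoin_range_t]
        trivial
      induction hy using Algebra.adjoin_induction with
      | mem y hy =>
        obtain ⟨i, j, r, rfl⟩ := hy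
        exact hN i j r
      | algebraMap a =>
        intro m hm
        rw [AlgHom.commutes]
        exact N.smul_mem a hm
      | add a b _ _ ha hb =>
        intro m hm
        rw [map_add]
        exact N.add_mem (ha m hm) (hb m hm)
      | mul a b _ _ ha hb =>
        intro m hm
        rw [map_mul]
        exact ha _ (hb m hm)
    let N' : Submodule (Yangian n) M := { N.toAddSubmonoid with smul_mem' := fun y m hm => hall y m hm }
    have hmem : ∀ m, m ∈ N' ↔ m ∈ N := fun _ => Iff.rfl
    refine (h N').imp (fun e => ?_) fun e => ?_
    · ext m
      rw [← hmem, e, Submodule.mem_bot, Submodule.mem_bot]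
    · ext m
      rw [← hmem, e]
      exact ⟨fun _ => trivial, fun _ => trivial⟩
  · let N' : Submodule ℂ M := { N.toAddSubmonoid with
      smul_mem' := fun a m hm => by
        have := N.smul_mem (algebraMap ℂ (Yangian n) a) hm
        rwa [hsmul, AlgHom.commutes] at this }
    have hmem : ∀ m, m ∈ N' ↔ m ∈ N := fun _ => Iff.rfl
    refine (h N' fun i j r m hm => N.smul_mem (t i j r) hm).imp (fun e => ?_) fun e => ?_
    · ext m
      rw [← hmem, e, Submodule.mem_bot, Submodule.mem_bot]
    · ext m
      rw [← hmem, e]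
      exact ⟨fun _ => trivial, fun _ => trivial⟩

/-! ### The action of the generators on tensor products of evaluation modules -/

theorem tensorCons_tmul_one {A : Type*} [Ring A] [Algebra ℂ A] (k : ℕ) (x : A) :
    tensorCons A k (x ⊗ₜ 1) = PiTensorProduct.singleAlgHom (R := ℂ) (0 : Fin (k + 1)) x := by
  have : tensorCons A k (x ⊗ₜ 1) = tensorConsLinear A k (x ⊗ₜ 1) := rfl
  rw [this, PiTensorProduct.one_def, tensorConsLinear_tmul_tprod]
  show _ = PiTensorProduct.tprod ℂ _
  congr 1
  ext p
  refine Fin.cases ?_ (fun p => ?_) p <;> simp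

theorem tensorCons_one_tmul_single {A : Type*} [Ring A] [Algebra ℂ A] (k : ℕ) (p : Fin k) (x : A) :
    tensorCons A k (1 ⊗ₜ PiTensorProduct.singleAlgHom (R := ℂ) p x)
      = PiTensorProduct.singleAlgHom (R := ℂ) p.succ x := by
  show tensorConsLinear A k (1 ⊗ₜ PiTensorProduct.tprod ℂ _) = PiTensorProduct.tprod ℂ _
  rw [tensorConsLinear_tmul_tprod]
  congr 1
  ext q
  refine Fin.cases ?_ (fun q => ?_) q
  · simp [(Fin.succ_ne_zero p).symm]
  · simp [Pi.mulSingle_apply]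

/-- The coproduct of the matrix $t(u)$ is a matrix product; iterating it multiplies, in order, the
copies of $t(u)$ placed in the successive tensor factors. -/
theorem iteratedComul_t {n : ℕ} (k : ℕ) (i j : Fin n) (r : ℕ) :
    iteratedComul n k (t i j r) = prodFamily k
      (fun p i j r => PiTensorProduct.singleAlgHom (R := ℂ) p (t i j r : Yangian n)) i j r := by
  induction k generalizing i j r with
  | zero =>
    simp only [iteratedComul, AlgHom.comp_apply, counit, lift_t, prodFamily]
    split_ifs <;> simp
  | succ k ih =>
    have h : ∀ (x : Yangian n) (a : Fin n) (s : ℕ),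
        tensorCons (Yangian n) k (x ⊗ₜ iteratedComul n k (t a j s))
          = PiTensorProduct.singleAlgHom (R := ℂ) (0 : Fin (k + 1)) x * prodFamily k
            (fun p i j r => PiTensorProduct.singleAlgHom (R := ℂ) p.succ (t i j r)) a j s := by
      intro x a s
      rw [← tensorCons_tmul_one, ih]
      -- The homomorphism $y\mapsto 1\otimes y$ moves the $p$-th factor to position $p+1$, hence
      -- carries the product for $k$ factors to the tail of the product for $k+1$.
      have e := map_prodFamily
        (((tensorCons (Yangian n) k).comp Algebra.TensorProduct.includeRight :
          (⨂[ℂ] _ : Fin k, Yangian n) →ₐ[ℂ] _) : _ →+* ⨂[ℂ] _ : Fin (k + 1), Yangian n) k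
        (fun p i j r => PiTensorProduct.singleAlgHom (R := ℂ) p (t i j r : Yangian n)) a j s
      simp only [RingHom.coe_coe, AlgHom.comp_apply, Algebra.TensorProduct.includeRight_apply,
        tensorCons_one_tmul_single] at e
      rw [← e, ← map_mul, Algebra.TensorProduct.tmul_mul_tmul, mul_one, one_mul]
    simp only [iteratedComul, AlgHom.comp_apply, comul, lift_t, map_sum,
      Algebra.TensorProduct.map_tmul, AlgHom.id_apply, h, prodFamily, mulFamily]

/-- The operator on `V 1 ⊗ ⋯ ⊗ V k` given by an operator on the `p`-th factor. -/
def factorEnd {k : ℕ} (V : Fin k → Type*) [∀ p, AddCommGroup (V p)] [∀ p, Module ℂ (V p)]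
    (p : Fin k) : Module.End ℂ (V p) →ₗ[ℂ] Module.End ℂ (⨂[ℂ] p, V p) :=
  (PiTensorProduct.mapMultilinear ℂ V V).toLinearMap (fun _ => LinearMap.id) p

theorem factorEnd_apply {k : ℕ} (V : Fin k → Type*) [∀ p, AddCommGroup (V p)]
    [∀ p, Module ℂ (V p)] (p : Fin k) (f : Module.End ℂ (V p)) :
    factorEnd V p f = PiTensorProduct.map (Function.update (fun _ => LinearMap.id) p f) := rfl

theorem factorEnd_one {k : ℕ} (V : Fin k → Type*) [∀ p, AddCommGroup (V p)]
    [∀ p, Module ℂ (V p)] (p : Fin k) : factorEnd V p 1 = 1 := by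
  rw [factorEnd_apply]
  have : Function.update (fun p => (LinearMap.id : V p →ₗ[ℂ] V p)) p 1
      = fun p => (LinearMap.id : V p →ₗ[ℂ] V p) := Function.update_eq_self p _
  rw [this, PiTensorProduct.map_id]
  rfl

theorem outerTensor_single {A : Type*} [Ring A] [Algebra ℂ A] {k : ℕ} {V : Fin k → Type*}
    [∀ p, AddCommGroup (V p)] [∀ p, Module ℂ (V p)] (ρ : ∀ p, A →ₐ[ℂ] Module.End ℂ (V p))
    (p : Fin k) (x : A) :
    outerTensor ρ (PiTensorProduct.singleAlgHom (R := ℂ) p x) = factorEnd V p (ρ p x) := by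
  have h : (fun q => (ρ q).toLinearMap (Pi.mulSingle (M := fun _ => A) p x q))
      = Function.update (fun q => (LinearMap.id : V q →ₗ[ℂ] V q)) p (ρ p x) := by
    ext1 q
    by_cases h : q = p
    · subst h; simp
    · simp [h, Module.End.one_eq_id]
  rw [factorEnd_apply, ← h]
  refine (PiTensorProduct.lift.tprod _).trans ?_
  simp

/-- The matrix of operators by which the matrix units act. -/
def glMatrix (n : ℕ) (V : Type*) [AddCommGroup V] [Module ℂ V]
    [LieRingModule (Matrix (Fin n) (Fin n) ℂ) V] [LieModule ℂ (Matrix (Fin n) (Fin n) ℂ) V] :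
    Matrix (Fin n) (Fin n) (Module.End ℂ V) :=
  Matrix.of fun i j => LieModule.toEnd ℂ (Matrix (Fin n) (Fin n) ℂ) V (Matrix.single i j 1)

theorem evalRep_t {n : ℕ} (V : Type*) [AddCommGroup V] [Module ℂ V]
    [LieRingModule (Matrix (Fin n) (Fin n) ℂ) V] [LieModule ℂ (Matrix (Fin n) (Fin n) ℂ) V]
    (i j : Fin n) (r : ℕ) : evalRep n V (t i j r) = evalFamily (glMatrix n V) i j r := by
  simp only [evalRep, AlgHom.comp_apply, evalHom, lift_t]
  rcases r with _ | _ | r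
  · simp only [evalFamily]
    split_ifs <;> simp
  · simp [evalFamily, glMatrix]
  · simp [evalFamily]

theorem tensorRep_evalRep_t {n k : ℕ} (V : Fin k → Type*) [∀ p, AddCommGroup (V p)]
    [∀ p, Module ℂ (V p)] [∀ p, LieRingModule (Matrix (Fin n) (Fin n) ℂ) (V p)]
    [∀ p, LieModule ℂ (Matrix (Fin n) (Fin n) ℂ) (V p)] (i j : Fin n) (r : ℕ) :
    tensorRep (fun p => evalRep n (V p)) (t i j r) = prodFamily k
      (fun p => evalFamily ((glMatrix n (V p)).map (factorEnd V p))) i j r := by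
  have h := map_prodFamily (outerTensor (fun p => evalRep n (V p)) :
    (⨂[ℂ] _ : Fin k, Yangian n) →+* Module.End ℂ (⨂[ℂ] p, V p)) k
    (fun p i j r => PiTensorProduct.singleAlgHom (R := ℂ) p (t i j r : Yangian n)) i j r
  rw [tensorRep, AlgHom.comp_apply, iteratedComul_t]
  refine h.trans ?_
  congr 1
  ext1 p
  ext i j r
  simp only [RingHom.coe_coe, outerTensor_single, evalRep_t]
  rcases r with _ | _ | r
  · simp only [evalFamily]
    split_ifs <;> simp [factorEnd_one]
  · simp [evalFamily]
  · simp [evalFamily]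

end Yangian

/-! ### Uniqueness of the irreducible module with a given highest weight -/

/-- The operators `E i j` on a module satisfy the commutation relations of `gl_n`. -/
def IsGlAction {n : ℕ} {U : Type*} [AddCommGroup U] [Module ℂ U]
    (E : Matrix (Fin n) (Fin n) (Module.End ℂ U)) : Prop :=
  ∀ i j k l, E i j * E k l - E k l * E i j
    = (if k = j then E i l else 0) - if i = l then E k j else 0

/-- `x` is killed by the raising operators and is a weight vector of weight `mu`. -/
structure IsHighestWeightVector {n : ℕ} {U : Type*} [AddCommGroup U] [Module ℂ U]
    (E : Matrix (Fin n) (Fin n) (Module.End ℂ U)) (mu : Fin n → ℂ) (x : U) : Prop where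
  raise : ∀ i j, i < j → E i j x = 0
  weight : ∀ i, E i i x = mu i • x

/-! ### The submodule generated by a highest weight vector. -/

section Lowering

variable {n : ℕ} {U : Type*} [AddCommGroup U] [Module ℂ U]

/-- The span of the vectors obtained from `x` by at most `m` lowering operators. -/
def lowerings (E : Matrix (Fin n) (Fin n) (Module.End ℂ U)) (x : U) : ℕ → Submodule ℂ U
  | 0 => Submodule.span ℂ {x}
  | m + 1 => lowerings E x m ⊔ ⨆ i, ⨆ j, ⨆ _ : j < i, (lowerings E x m).map (E i j)

theorem lowerings_mono (E : Matrix (Fin n) (Fin n) (Module.End ℂ U)) (x : U) :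
    Monotone (lowerings E x) :=
  monotone_nat_of_le_succ fun _ => le_sup_left

theorem lower_mem_lowerings (E : Matrix (Fin n) (Fin n) (Module.End ℂ U)) (x : U) {m : ℕ}
    {i j : Fin n} (h : j < i) {y : U} (hy : y ∈ lowerings E x m) :
    E i j y ∈ lowerings E x (m + 1) :=
  Submodule.mem_sup_right <| Submodule.mem_iSup_of_mem i <| Submodule.mem_iSup_of_mem j <|
    Submodule.mem_iSup_of_mem h <| Submodule.mem_map_of_mem hy

/-- Move the raising or diagonal operator to the right past the last lowering operator. The
commutator is a difference of at most two matrix units applied to a vector of the previous level, so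
the level does not grow. -/
theorem raise_mem_lowerings {E : Matrix (Fin n) (Fin n) (Module.End ℂ U)} (hE : IsGlAction E)
    {mu : Fin n → ℂ} {x : U} (hx : IsHighestWeightVector E mu x) (m : ℕ) {i j : Fin n}
    (h : i ≤ j) {y : U} (hy : y ∈ lowerings E x m) : E i j y ∈ lowerings E x m := by
  induction m generalizing i j y with
  | zero =>
    obtain ⟨a, rfl⟩ := Submodule.mem_span_singleton.1 hy
    rw [map_smul]
    refine Submodule.smul_mem _ _ ?_
    rcases h.lt_or_eq with h | rfl
    · rw [hx.raise i j h]
      exact Submodule.zero_mem _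
    · rw [hx.weight]
      exact Submodule.smul_mem _ _ (Submodule.mem_span_singleton_self x)
  | succ m ih =>
    have hall : ∀ (i j : Fin n) (y : U), y ∈ lowerings E x m → E i j y ∈ lowerings E x (m + 1) := by
      intro i j y hy
      rcases le_or_gt i j with h | h
      · exact lowerings_mono E x m.le_succ (ih h hy)
      · exact lower_mem_lowerings E x h hy
    suffices lowerings E x (m + 1) ≤ (lowerings E x (m + 1)).comap (E i j) from this hy
    refine sup_le (fun y hy => hall i j y hy) (iSup_le fun a => iSup_le fun b => iSup_le fun hab => ?_)
    rintro _ ⟨z, hz, rfl⟩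
    have e : E i j (E a b z) = E a b (E i j z)
        + ((if a = j then E i b z else 0) - if i = b then E a j z else 0) := by
      have := LinearMap.congr_fun (hE i j a b) z
      simp only [LinearMap.sub_apply, Module.End.mul_apply] at this
      rw [sub_eq_iff_eq_add'] at this
      rw [this]
      congr 2 <;> split_ifs <;> rfl
    rw [Submodule.mem_comap, e]
    refine Submodule.add_mem _ (hall a b _ (ih h hz)) (Submodule.sub_mem _ ?_ ?_)
    · split_ifs
      exacts [hall _ _ _ hz, Submodule.zero_mem _]
    · split_ifs
      exacts [hall _ _ _ hz, Submodule.zero_mem _]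

/-- An operator whose eigenvalues increase under the lowering operators. -/
def gradingOperator (E : Matrix (Fin n) (Fin n) (Module.End ℂ U)) : Module.End ℂ U :=
  ∑ i : Fin n, ((i : ℕ) : ℂ) • E i i

theorem gradingOperator_apply (E : Matrix (Fin n) (Fin n) (Module.End ℂ U)) {mu : Fin n → ℂ}
    {x : U} (hx : ∀ i, E i i x = mu i • x) :
    gradingOperator E x = (∑ i : Fin n, ((i : ℕ) : ℂ) * mu i) • x := by
  simp [gradingOperator, hx, Finset.sum_smul, smul_smul]

theorem gradingOperator_mul {E : Matrix (Fin n) (Fin n) (Module.End ℂ U)} (hE : IsGlAction E)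
    (i j : Fin n) : gradingOperator E * E i j
      = E i j * gradingOperator E + (((i : ℕ) : ℂ) - ((j : ℕ) : ℂ)) • E i j := by
  rw [← sub_eq_iff_eq_add', gradingOperator, Finset.sum_mul, Finset.mul_sum,
    ← Finset.sum_sub_distrib]
  have : ∀ a : Fin n, (((a : ℕ) : ℂ) • E a a) * E i j - E i j * (((a : ℕ) : ℂ) • E a a)
      = (if i = a then ((a : ℕ) : ℂ) • E a j else 0)
        - if a = j then ((a : ℕ) : ℂ) • E i a else 0 := by
    intro a
    rw [smul_mul_assoc, mul_smul_comm, ← smul_sub, hE, smul_sub, smul_ite, smul_ite, smul_zero]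
  simp only [this, Finset.sum_sub_distrib]
  simp [sub_smul]

/-- A lowering operator $E_{ij}$, $j<i$, adds the positive integer $i-j$ to the eigenvalue of the
grading operator. Only multiples of $x$ itself stay at the eigenvalue $a$; the index `d + 1` keeps
$a$ out of the supremum. -/
theorem lowerings_le {E : Matrix (Fin n) (Fin n) (Module.End ℂ U)} (hE : IsGlAction E)
    {a : ℂ} {x : U} (hx : gradingOperator E x = a • x) (m : ℕ) :
    lowerings E x m ≤ Submodule.span ℂ {x}
      ⊔ ⨆ d : ℕ, (gradingOperator E).eigenspace (a + (d + 1 : ℕ)) := by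
  have key : ∀ {i j : Fin n}, j < i → ∀ (d : ℕ) (y : U), gradingOperator E y = (a + d) • y →
      E i j y ∈ ⨆ d : ℕ, (gradingOperator E).eigenspace (a + (d + 1 : ℕ)) := by
    intro i j h d y hy
    obtain ⟨e, he⟩ : ∃ e : ℕ, (i : ℕ) = j + (e + 1) :=
      ⟨i - j - 1, by have : (j : ℕ) < i := h; omega⟩
    -- With $i-j=e+1$ the new eigenvalue is $a+d+(e+1)=a+((d+e)+1)$.
    refine Submodule.mem_iSup_of_mem (d + e) (Module.End.mem_eigenspace_iff.2 ?_)
    have := LinearMap.congr_fun (gradingOperator_mul hE i j) y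
    simp only [LinearMap.add_apply, Module.End.mul_apply, LinearMap.smul_apply, hy, map_smul] at this
    rw [this, ← add_smul, he]
    congr 1
    push_cast
    ring
  induction m with
  | zero => exact le_sup_left
  | succ m ih =>
    refine sup_le ih (iSup_le fun i => iSup_le fun j => iSup_le fun hij => ?_)
    refine (Submodule.map_mono ih).trans ?_
    rw [Submodule.map_sup, Submodule.map_iSup]
    refine (sup_le ?_ (iSup_le fun d => ?_)).trans le_sup_right
    · rw [Submodule.map_span_le]
      rintro _ rfl
      exact key hij 0 _ (by simpa using hx)
    · rintro _ ⟨y, hy, rfl⟩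
      exact key hij (d + 1) y (Module.End.mem_eigenspace_iff.1 hy)

/-- A highest weight vector is contained in a submodule in which its weight space is a line. -/
theorem exists_submodule_weightSpace_le_span {E : Matrix (Fin n) (Fin n) (Module.End ℂ U)}
    (hE : IsGlAction E) {mu : Fin n → ℂ} {x : U} (hx : IsHighestWeightVector E mu x) :
    ∃ N : Submodule ℂ U, x ∈ N ∧ (∀ i j, ∀ y ∈ N, E i j y ∈ N) ∧
      ∀ y ∈ N, (∀ i, E i i y = mu i • y) → y ∈ Submodule.span ℂ {x} := by
  have hdir : Directed (· ≤ ·) (lowerings E x) := (lowerings_mono E x).directed_le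
  refine ⟨⨆ m, lowerings E x m,
    Submodule.mem_iSup_of_mem 0 (Submodule.mem_span_singleton_self x), fun i j y hy => ?_,
    fun y hy hw => ?_⟩
  · obtain ⟨m, hm⟩ := (Submodule.mem_iSup_of_directed _ hdir).1 hy
    rcases le_or_gt i j with h | h
    · exact Submodule.mem_iSup_of_mem m (raise_mem_lowerings hE hx m h hm)
    · exact Submodule.mem_iSup_of_mem (m + 1) (lower_mem_lowerings E x h hm)
  · have hxa := gradingOperator_apply E hx.weight
    have hya := gradingOperator_apply E hw
    set a := ∑ i : Fin n, ((i : ℕ) : ℂ) * mu i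
    obtain ⟨u, hu, z, hz, rfl⟩ := Submodule.mem_sup.1 (iSup_le (lowerings_le hE hxa) hy)
    have hua : u ∈ (gradingOperator E).eigenspace a := by
      obtain ⟨b, rfl⟩ := Submodule.mem_span_singleton.1 hu
      exact Submodule.smul_mem _ _ (Module.End.mem_eigenspace_iff.2 hxa)
    have hza : z ∈ (gradingOperator E).eigenspace a := by
      have := Submodule.sub_mem _ (Module.End.mem_eigenspace_iff.2 hya) hua
      rwa [add_sub_cancel_left] at this
    -- The remainder $z$ has eigenvalue $a$ but also lies in the sum of the other eigenspaces, so it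
    -- vanishes.
    have hdisj := (gradingOperator E).eigenspaces_iSupIndep a
    have hle : ⨆ d : ℕ, (gradingOperator E).eigenspace (a + (d + 1 : ℕ))
        ≤ ⨆ b, ⨆ _ : b ≠ a, (gradingOperator E).eigenspace b :=
      iSup_le fun d => le_iSup₂_of_le (a + (d + 1 : ℕ))
        (fun h => Nat.cast_ne_zero.2 d.succ_ne_zero (add_eq_left.1 h)) le_rfl
    have hz0 : z = 0 := (Submodule.disjoint_def.1 hdisj) z hza (hle hz)
    rwa [hz0, add_zero]

end Lowering

/-- Two irreducible modules over `gl_n` that have highest weight vectors of the same weight are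
isomorphic. -/
theorem exists_linearEquiv_of_isHighestWeightVector {n : ℕ} {V W : Type*} [AddCommGroup V]
    [Module ℂ V] [AddCommGroup W] [Module ℂ W] {E : Matrix (Fin n) (Fin n) (Module.End ℂ V)}
    {F : Matrix (Fin n) (Fin n) (Module.End ℂ W)} (hE : IsGlAction E) (hF : IsGlAction F)
    (iE : ∀ N : Submodule ℂ V, (∀ i j, ∀ y ∈ N, E i j y ∈ N) → N = ⊥ ∨ N = ⊤)
    (iF : ∀ N : Submodule ℂ W, (∀ i j, ∀ y ∈ N, F i j y ∈ N) → N = ⊥ ∨ N = ⊤)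
    {mu : Fin n → ℂ} {v : V} {w : W} (hv : IsHighestWeightVector E mu v)
    (hw : IsHighestWeightVector F mu w) (v0 : v ≠ 0) (w0 : w ≠ 0) :
    ∃ φ : V ≃ₗ[ℂ] W, ∀ i j y, φ (E i j y) = F i j (φ y) := by
  -- The isomorphism is obtained from its graph: the submodule of $V\times W$ generated by $(v,w)$.
  let G : Matrix (Fin n) (Fin n) (Module.End ℂ (V × W)) :=
    Matrix.of fun i j => (E i j).prodMap (F i j)
  have hGapp : ∀ i j y, G i j y = (E i j y.1, F i j y.2) := fun _ _ _ => rfl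
  have hG : IsGlAction G := by
    intro i j k l
    refine LinearMap.ext fun y => Prod.ext ?_ ?_
    · have := LinearMap.congr_fun (hE i j k l) y.1
      simp only [LinearMap.sub_apply, Module.End.mul_apply, hGapp, Prod.fst_sub] at this ⊢
      rw [this]
      congr 1 <;> split_ifs <;> rfl
    · have := LinearMap.congr_fun (hF i j k l) y.2
      simp only [LinearMap.sub_apply, Module.End.mul_apply, hGapp, Prod.snd_sub] at this ⊢
      rw [this]
      congr 1 <;> split_ifs <;> rfl
  have hx : IsHighestWeightVector G mu (v, w) :=
    ⟨fun i j h => by simp [hGapp, hv.raise i j h, hw.raise i j h],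
      fun i => by simp [hGapp, hv.weight, hw.weight]⟩
  obtain ⟨N, hxN, hN, hline⟩ := exists_submodule_weightSpace_le_span hG hx
  -- If $N$ contained $0\times W$, then $(0,w)$ would be a vector of weight $\mu$ in $N$, hence a
  -- multiple of $(v,w)$, which $v\ne0$ and $w\ne0$ exclude. Irreducibility of $W$ leaves only zero.
  have k1 : N.comap (LinearMap.inr ℂ V W) = ⊥ := by
    refine (iF _ fun i j y hy => ?_).resolve_right fun htop => w0 ?_
    · simpa [hGapp] using hN i j _ hy
    · have hmem : w ∈ N.comap (LinearMap.inr ℂ V W) := htop ▸ trivial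
      obtain ⟨a, ha⟩ := Submodule.mem_span_singleton.1
        (hline _ hmem fun i => by simp [hGapp, hw.weight])
      simp only [Prod.smul_mk, LinearMap.inr_apply, Prod.mk.injEq, smul_eq_zero, v0, or_false] at ha
      rw [← ha.2, ha.1, zero_smul]
  have k2 : N.comap (LinearMap.inl ℂ V W) = ⊥ := by
    refine (iE _ fun i j y hy => ?_).resolve_right fun htop => v0 ?_
    · simpa [hGapp] using hN i j _ hy
    · have hmem : v ∈ N.comap (LinearMap.inl ℂ V W) := htop ▸ trivial
      obtain ⟨a, ha⟩ := Submodule.mem_span_singleton.1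
        (hline _ hmem fun i => by simp [hGapp, hv.weight])
      simp only [Prod.smul_mk, LinearMap.inl_apply, Prod.mk.injEq, smul_eq_zero, w0, or_false] at ha
      rw [← ha.1, ha.2, zero_smul]
  have s1 : N.map (LinearMap.fst ℂ V W) = ⊤ := by
    refine (iE _ ?_).resolve_left fun hbot => v0 ?_
    · rintro i j _ ⟨y, hy, rfl⟩
      exact ⟨_, hN i j y hy, rfl⟩
    · have : v ∈ N.map (LinearMap.fst ℂ V W) := ⟨_, hxN, rfl⟩
      rwa [hbot, Submodule.mem_bot] at this
  have s2 : N.map (LinearMap.snd ℂ V W) = ⊤ := by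
    refine (iF _ ?_).resolve_left fun hbot => w0 ?_
    · rintro i j _ ⟨y, hy, rfl⟩
      exact ⟨_, hN i j y hy, rfl⟩
    · have : w ∈ N.map (LinearMap.snd ℂ V W) := ⟨_, hxN, rfl⟩
      rwa [hbot, Submodule.mem_bot] at this
  -- The kernel of each projection of $N$ is its intersection with the other factor, which is zero;
  -- its image is nonzero and invariant, hence everything.
  have b1 : Function.Bijective ((LinearMap.fst ℂ V W).domRestrict N) := by
    constructor
    · rw [injective_iff_map_eq_zero]
      rintro ⟨⟨a, b⟩, hab⟩ rfl
      have : b ∈ N.comap (LinearMap.inr ℂ V W) := hab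
      rw [k1, Submodule.mem_bot] at this
      subst this
      rfl
    · intro a
      obtain ⟨y, hy, rfl⟩ : a ∈ N.map (LinearMap.fst ℂ V W) := s1 ▸ trivial
      exact ⟨⟨y, hy⟩, rfl⟩
  have b2 : Function.Bijective ((LinearMap.snd ℂ V W).domRestrict N) := by
    constructor
    · rw [injective_iff_map_eq_zero]
      rintro ⟨⟨a, b⟩, hab⟩ rfl
      have : a ∈ N.comap (LinearMap.inl ℂ V W) := hab
      rw [k2, Submodule.mem_bot] at this
      subst this
      rfl
    · intro a
      obtain ⟨y, hy, rfl⟩ : a ∈ N.map (LinearMap.snd ℂ V W) := s2 ▸ trivial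
      exact ⟨⟨y, hy⟩, rfl⟩
  refine ⟨(LinearEquiv.ofBijective _ b1).symm.trans (LinearEquiv.ofBijective _ b2),
    fun i j y => ?_⟩
  obtain ⟨z, rfl⟩ := (LinearEquiv.ofBijective _ b1).surjective y
  have e : E i j (LinearEquiv.ofBijective _ b1 z)
      = LinearEquiv.ofBijective _ b1 ⟨G i j z, hN i j z z.2⟩ := rfl
  rw [e, LinearEquiv.trans_apply, LinearEquiv.trans_apply, LinearEquiv.symm_apply_apply,
    LinearEquiv.symm_apply_apply]
  rfl

/-! ### Shifted highest weights -/

/-- The added scalars are central, so the commutators are unchanged. On the right they contribute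
$\delta_{kj}\delta_{il}c-\delta_{il}\delta_{kj}c=0$. -/
theorem isGlAction_add_algebraMap {n : ℕ} {U : Type*} [AddCommGroup U] [Module ℂ U]
    {E : Matrix (Fin n) (Fin n) (Module.End ℂ U)} (hE : IsGlAction E) (c : ℂ) :
    IsGlAction (E + algebraMap ℂ _ c) := by
  have hcomm : ∀ (i j : Fin n) (f : Module.End ℂ U), Commute
      ((algebraMap ℂ (Matrix (Fin n) (Fin n) (Module.End ℂ U)) c) i j) f := by
    intro i j f
    rw [Matrix.algebraMap_matrix_apply]
    split_ifs
    exacts [Algebra.commute_algebraMap_left c f, Commute.zero_left f]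
  intro i j k l
  set D := algebraMap ℂ (Matrix (Fin n) (Fin n) (Module.End ℂ U)) c
  have hD : (if k = j then D i l else 0) - (if i = l then D k j else 0) = 0 := by
    simp only [D, Matrix.algebraMap_matrix_apply]
    split_ifs <;> simp
  have hR : ((if k = j then (E + D) i l else 0) - if i = l then (E + D) k j else 0)
      = ((if k = j then E i l else 0) - if i = l then E k j else 0)
        + ((if k = j then D i l else 0) - if i = l then D k j else 0) := by
    simp only [Matrix.add_apply]
    split_ifs <;> abel
  rw [hR, hD, add_zero, ← hE]
  simp only [Matrix.add_apply, add_mul, mul_add, (hcomm k l _).eq, (hcomm i j (E k l)).eq]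
  abel

theorem isGlAction_glMatrix (n : ℕ) (V : Type*) [AddCommGroup V] [Module ℂ V]
    [LieRingModule (Matrix (Fin n) (Fin n) ℂ) V] [LieModule ℂ (Matrix (Fin n) (Fin n) ℂ) V] :
    IsGlAction (Yangian.glMatrix n V) := by
  intro i j k l
  simp only [Yangian.glMatrix, Matrix.of_apply]
  rw [← LieRing.of_associative_ring_bracket, ← LieHom.map_lie,
    LieRing.of_associative_ring_bracket, map_sub]
  congr 1
  · split_ifs with h
    · subst h; simp
    · rw [Matrix.single_mul_single_of_ne (h := fun h' => h h'.symm), map_zero]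
  · split_ifs with h
    · subst h; simp
    · rw [Matrix.single_mul_single_of_ne (h := fun h' => h h'.symm), map_zero]

namespace IsGlIrrep

variable {n : ℕ} {lam : Fin n → ℂ} {V : Type*} [AddCommGroup V] [Module ℂ V]
  [LieRingModule (Matrix (Fin n) (Fin n) ℂ) V] [LieModule ℂ (Matrix (Fin n) (Fin n) ℂ) V]

/-- Matrix units span $\mathfrak{gl}_n$, so stability under them already gives a Lie submodule. -/
theorem eq_bot_or_eq_top (hV : IsGlIrrep lam V) (N : Submodule ℂ V)
    (hN : ∀ i j, ∀ y ∈ N, Yangian.glMatrix n V i j y ∈ N) : N = ⊥ ∨ N = ⊤ := by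
  let N' : LieSubmodule ℂ (Matrix (Fin n) (Fin n) ℂ) V :=
    { N with
      lie_mem := by
        intro x m hm
        rw [Matrix.matrix_eq_sum_single x, sum_lie]
        refine N.sum_mem fun i _ => ?_
        rw [sum_lie]
        refine N.sum_mem fun j _ => ?_
        rw [← mul_one (x i j), ← smul_eq_mul, ← Matrix.smul_single, smul_lie]
        exact N.smul_mem _ (hN i j m hm) }
  have := hV.irreducible
  have hN' : (N' : Submodule ℂ V) = N := rfl
  refine (IsSimpleOrder.eq_bot_or_eq_top N').imp (fun h => ?_) fun h => ?_
  · rw [← hN', h, LieSubmodule.bot_toSubmodule]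
  · rw [← hN', h, LieSubmodule.top_toSubmodule]

theorem exists_isHighestWeightVector (hV : IsGlIrrep lam V) :
    ∃ v : V, v ≠ 0 ∧ IsHighestWeightVector (Yangian.glMatrix n V) lam v := by
  obtain ⟨v, v0, h1, h2⟩ := hV.exists_highestWeightVector
  exact ⟨v, v0, h1, h2⟩

/-- `L(λ + c)` is `L(λ)` with `E_ij` acting as `E_ij + δ_ij c`. -/
theorem exists_linearEquiv_shift (hV : IsGlIrrep lam V) {c : ℂ} {W : Type*} [AddCommGroup W]
    [Module ℂ W] [LieRingModule (Matrix (Fin n) (Fin n) ℂ) W]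
    [LieModule ℂ (Matrix (Fin n) (Fin n) ℂ) W] (hW : IsGlIrrep (fun i => lam i + c) W) :
    ∃ φ : V ≃ₗ[ℂ] W, ∀ i j y,
      φ ((Yangian.glMatrix n V + algebraMap ℂ _ c) i j y) = Yangian.glMatrix n W i j (φ y) := by
  obtain ⟨v, v0, hv⟩ := hV.exists_isHighestWeightVector
  obtain ⟨w, w0, hw⟩ := hW.exists_isHighestWeightVector
  have happ : ∀ i j y, (Yangian.glMatrix n V + algebraMap ℂ _ c) i j y
      = Yangian.glMatrix n V i j y + if i = j then c • y else 0 := by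
    intro i j y
    rw [Matrix.add_apply, LinearMap.add_apply, Matrix.algebraMap_matrix_apply]
    congr 1
    split_ifs <;> rfl
  refine exists_linearEquiv_of_isHighestWeightVector
    (isGlAction_add_algebraMap (isGlAction_glMatrix n V) c) (isGlAction_glMatrix n W)
    (fun N hN => hV.eq_bot_or_eq_top N fun i j y hy => ?_) hW.eq_bot_or_eq_top
    ⟨fun i j h => ?_, fun i => ?_⟩ hw v0 w0
  · have := hN i j y hy
    rw [happ] at this
    refine (N.add_mem_iff_left ?_).1 this
    split_ifs
    exacts [N.smul_mem c hy, N.zero_mem]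
  · rw [happ, hv.raise i j h, if_neg h.ne, add_zero]
  · rw [happ, hv.weight, if_pos rfl, add_smul]

end IsGlIrrep

/-! ### Transfer of irreducibility along the shift. -/

namespace Yangian

theorem factorEnd_algebraMap {k : ℕ} (V : Fin k → Type*) [∀ p, AddCommGroup (V p)]
    [∀ p, Module ℂ (V p)] (p : Fin k) (c : ℂ) :
    factorEnd V p (algebraMap ℂ _ c) = algebraMap ℂ _ c := by
  rw [Algebra.algebraMap_eq_smul_one, Algebra.algebraMap_eq_smul_one, map_smul, factorEnd_one]

theorem congr_conj_factorEnd {k : ℕ} {V W : Fin k → Type*} [∀ p, AddCommGroup (V p)]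
    [∀ p, Module ℂ (V p)] [∀ p, AddCommGroup (W p)] [∀ p, Module ℂ (W p)]
    (φ : ∀ p, V p ≃ₗ[ℂ] W p) (p : Fin k) (f : Module.End ℂ (V p)) (g : Module.End ℂ (W p))
    (h : ∀ y, φ p (f y) = g (φ p y)) :
    (PiTensorProduct.congr φ).conjAlgEquiv ℂ (factorEnd V p f) = factorEnd W p g := by
  have e : (PiTensorProduct.congr φ).toLinearMap ∘ₗ factorEnd V p f
      = factorEnd W p g ∘ₗ (PiTensorProduct.congr φ).toLinearMap := by
    apply PiTensorProduct.ext
    ext v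
    simp only [factorEnd_apply, LinearMap.compMultilinearMap_apply, LinearMap.comp_apply,
      PiTensorProduct.map_tprod, LinearEquiv.coe_coe, PiTensorProduct.congr_tprod]
    congr 1
    ext q
    by_cases hq : q = p
    · subst hq; simp [h]
    · simp [hq]
  refine LinearMap.ext fun y => ?_
  obtain ⟨z, rfl⟩ := (PiTensorProduct.congr φ).surjective y
  have := LinearMap.congr_fun e z
  simpa [LinearEquiv.conjAlgEquiv] using this

/-- Pull an invariant subspace of the tensor product of the `W p` back along the tensor product of
the isomorphisms. The result is stable under the shifted operators, hence under the unshifted ones,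
hence trivial. -/
theorem isIrreducibleRep_tensorRep_shift {n k : ℕ} {lam : Fin k → Fin n → ℂ} {c : ℂ}
    {V : Fin k → Type*} [∀ p, AddCommGroup (V p)] [∀ p, Module ℂ (V p)]
    [∀ p, LieRingModule (Matrix (Fin n) (Fin n) ℂ) (V p)]
    [∀ p, LieModule ℂ (Matrix (Fin n) (Fin n) ℂ) (V p)]
    (hV : ∀ p, IsGlIrrep (lam p) (V p))
    {W : Fin k → Type*} [∀ p, AddCommGroup (W p)] [∀ p, Module ℂ (W p)]
    [∀ p, LieRingModule (Matrix (Fin n) (Fin n) ℂ) (W p)]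
    [∀ p, LieModule ℂ (Matrix (Fin n) (Fin n) ℂ) (W p)]
    (hW : ∀ p, IsGlIrrep (fun i => lam p i + c) (W p))
    (h : IsIrreducibleRep (tensorRep fun p => evalRep n (V p))) :
    IsIrreducibleRep (tensorRep fun p => evalRep n (W p)) := by
  choose φ hφ using fun p => (hV p).exists_linearEquiv_shift (hW p)
  let E : Fin k → Matrix (Fin n) (Fin n) (Module.End ℂ (⨂[ℂ] p, V p)) :=
    fun p => (glMatrix n (V p)).map (factorEnd V p)
  let Φ := PiTensorProduct.congr φ
  have hconj : ∀ i j r, Φ.conjAlgEquiv ℂ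
      (prodFamily k (fun p => evalFamily (E p + algebraMap ℂ _ c)) i j r)
      = tensorRep (fun p => evalRep n (W p)) (t i j r) := by
    intro i j r
    rw [tensorRep_evalRep_t]
    refine (map_prodFamily (RingHomClass.toRingHom (Φ.conjAlgEquiv ℂ)) k _ i j r).trans ?_
    congr 1
    funext p i j r
    rcases r with _ | _ | r
    · simp only [evalFamily]
      split_ifs <;> simp
    · refine Eq.trans ?_ (congr_conj_factorEnd φ p _ _ (hφ p i j))
      simp only [evalFamily, Matrix.add_apply, map_add, E, Matrix.map_apply, RingHom.coe_coe]
      congr 2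
      simp only [Matrix.algebraMap_matrix_apply]
      split_ifs <;> simp [factorEnd_algebraMap]
    · simp [evalFamily]
  rw [isIrreducibleRep_iff] at h ⊢
  obtain ⟨hnt, hsub⟩ := h
  refine ⟨Φ.symm.toEquiv.nontrivial, fun N hN => ?_⟩
  -- The operators that preserve a given subspace form a complex subspace of the endomorphisms, so
  -- membership in it passes to linear combinations.
  have hshift : ∀ i j r, prodFamily k (fun p => evalFamily (E p + algebraMap ℂ _ c)) i j r
      ∈ (N.comap Φ.toLinearMap).compatibleMaps (N.comap Φ.toLinearMap) := by
    intro i j r m hm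
    have := hN i j r (Φ m) hm
    rw [← hconj] at this
    simpa [LinearEquiv.conjAlgEquiv] using this
  have hE : ∀ i j r, ∀ m ∈ N.comap Φ.toLinearMap,
      tensorRep (fun p => evalRep n (V p)) (t i j r) m ∈ N.comap Φ.toLinearMap := by
    intro i j r m hm
    -- Shifting back by $-c$ recovers the original matrices, $E_p+c-c=E_p$.
    have := prodFamily_evalFamily_shift_mem _ (-c) i j r _ (hshift i j)
    simp only [map_neg, add_neg_cancel_right] at this
    rw [tensorRep_evalRep_t]
    exact this hm
  have hmap : (N.comap Φ.toLinearMap).map Φ.toLinearMap = N :=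
    Submodule.map_comap_eq_of_surjective Φ.surjective N
  refine (hsub _ hE).imp (fun e => ?_) fun e => ?_
  · rw [← hmap, e, Submodule.map_bot]
  · rw [← hmap, e, Submodule.map_top, LinearEquiv.range]

end Yangian
end

theorem proposition2p6 (n k : ℕ) (lam : Fin k → Fin n → ℂ)
    (hlam : ∀ p, IsGlHighestWeight (lam p)) (c : ℂ)
    (V : Fin k → Type*) [∀ p, AddCommGroup (V p)] [∀ p, Module ℂ (V p)]
    [∀ p, LieRingModule (Matrix (Fin n) (Fin n) ℂ) (V p)]
    [∀ p, LieModule ℂ (Matrix (Fin n) (Fin n) ℂ) (V p)]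
    (hV : ∀ p, IsGlIrrep (lam p) (V p))
    (W : Fin k → Type*) [∀ p, AddCommGroup (W p)] [∀ p, Module ℂ (W p)]
    [∀ p, LieRingModule (Matrix (Fin n) (Fin n) ℂ) (W p)]
    [∀ p, LieModule ℂ (Matrix (Fin n) (Fin n) ℂ) (W p)]
    (hW : ∀ p, IsGlIrrep (fun i => lam p i + c) (W p)) :
    Yangian.IsIrreducibleRep (Yangian.tensorRep fun p => Yangian.evalRep n (V p)) ↔
      Yangian.IsIrreducibleRep (Yangian.tensorRep fun p => Yangian.evalRep n (W p)) :=
  ⟨Yangian.isIrreducibleRep_tensorRep_shift hV hW,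
    -- The converse is the same implication with the two families exchanged, because
    -- $\lambda^{(p)}+c-c=\lambda^{(p)}$.
    Yangian.isIrreducibleRep_tensorRep_shift (c := -c) hW fun p => by
      simpa only [add_neg_cancel_right] using hV p⟩
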